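/- Let $\mathbb H$ be the algebra of quaternions and let $\mathbb S=\{I\in\mathbb H:\ \mathrm{Re}\,I=0,\ |I|=1\}$. For $I\in\mathbb S$ put $L_I=\mathbb R+I\mathbb R$, identified with $\mathbb C$ through $x+Iy\leftrightarrow x+iy$. Let $V$ be a bilateral quaternionic Banach space, that is, a real Banach space with commuting left and right $\mathbb H$-vector space structures, both extending the real one, such that $\|av\|=|a|\,\|v\|=\|va\|$ for $a\in\mathbb H$, $v\in V$. Let $\mathcal B(V)$ be the Banach space of bounded right linear operators on $V$ with the operator norm, where $(Ta)(v)=T(av)$ and $(a\mathcal I)(v)=av$ for $a\in\mathbb H$. For $T\in\mathcal B(V)$ let $$\sigma_S(T)=\{s\in\mathbb H:\ T^2-2\,\mathrm{Re}[s]\,T+|s|^2\mathcal I\ \text{ is not invertible in } \mathcal B(V)\}$$ be its $S$-spectrum, and for $s\notin\sigma_S(T)$ let $$S^{-1}(s,T)=-(T^2-2\,\mathrm{Re}[s]\,T+|s|^2\mathcal I)^{-1}(T-\overline s\,\mathcal I).$$ A function $f$ is (left) regular on an open ball $B(0,R)\subset\mathbb H$ if it is real differentiable there and, for every $I\in\mathbb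 S$, $\frac12\big(\frac{\partial}{\partial x}+I\frac{\partial}{\partial y}\big)f(x+Iy)=0$ at all points $x+Iy\in B(0,R)$. For a bounded open set $U\subset L_I$, an oriented boundary of $U$ is a finite family of closed rectifiable curves in $L_I\cong\mathbb C$, given by Lipschitz parametrizations on $[0,1]$, whose traces have union $\partial U$ (the topological boundary in $L_I$) and whose total winding number is $1$ about each point of $U$ and $0$ about each point of $L_I\setminus\overline U$. Integrals over $\partial U$ are taken along such a family, and $ds_I=-I\,ds$. **Theorem.** Let $T\in\mathcal B(V)$, let $R>0$ with $\sigma_S(T)\subset B(0,R)$, and let $f:\mathbb H\to\mathbb H$ be regular on $B(0,R)$. For $I\in\mathbb S$, call $U\subset L_I$ admissible if it is open in $L_I$, bounded, contains $L_I\cap\sigma_S(T)$, and $\overline U\subset B(0,R)$. Then: 1. for every $I\in\mathbb S$ there is an admissible $U\subset L_I$ that has an oriented boundary; 2. for every $I\in\mathbb S$ and every admissible $U\subset L_I$ with an oriented boundary, the integrand of $$\frac1{2\pi}\int_{\partial U}S^{-1}(s,T)\,ds_I\,f(s)$$ is integrable along each boundary curve, so the integral exists as an element of $\mathcal B(V)$;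 3. the value of this integral depends neither on $I$, nor on $U$, nor on the choice of the oriented boundary: for all $I,I'\in\mathbb S$ and all admissible $U\subset L_I$, $U'\subset L_{I'}$ with oriented boundaries, $$\frac1{2\pi}\int_{\partial U}S^{-1}(s,T)\,ds_I\,f(s)=\frac1{2\pi}\int_{\partial U'}S^{-1}(s,T)\,ds_{I'}\,f(s).$$ In particular, $f(T)$, defined as this common value, is well defined. -/

import Mathlib

open Set MeasureTheory Metric
open scoped Quaternion MulOpposite

noncomputable section

namespace SCalculus

/-! ## Quaternions, slices and regular functions -/

/-- The sphere of purely imaginary unit quaternions. -/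
def imagUnits : Set ℍ[ℝ] := {I | I.re = 0 ∧ ‖I‖ = 1}

/-- The identification `x + i y ↦ x + I y` of the complex plane with the slice
`L_I = ℝ + I ℝ`. -/
def slice (I : ℍ[ℝ]) (z : ℂ) : ℍ[ℝ] := (z.re : ℍ[ℝ]) + I * (z.im : ℍ[ℝ])

/-- Left (slice) regularity on an open set `B`: `f` is real differentiable on `B` and, for every
imaginary unit `I`, the restriction `f_I` of `f` to the slice `L_I` satisfies
`(1/2) (∂/∂x + I ∂/∂y) f_I (x + I y) = 0` at all points `x + I y` of `B`. -/
def IsLeftRegularOn (f : ℍ[ℝ] → ℍ[ℝ]) (B : Set ℍ[ℝ]) : Prop :=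
  DifferentiableOn ℝ f B ∧
    ∀ I ∈ imagUnits, ∀ x y : ℝ, slice I ⟨x, y⟩ ∈ B →
      (1 / 2 : ℝ) • (deriv (fun x' : ℝ => f (slice I ⟨x', y⟩)) x
        + I * deriv (fun y' : ℝ => f (slice I ⟨x, y'⟩)) y) = 0

/-! ## Bounded right linear operators on a bilateral quaternionic Banach space -/

section Operators

variable {V : Type*} [NormedAddCommGroup V] [NormedSpace ℝ V]
  [Module ℍ[ℝ] V] [Module ℍ[ℝ]ᵐᵒᵖ V]
  [IsScalarTower ℝ ℍ[ℝ] V] [IsScalarTower ℝ ℍ[ℝ]ᵐᵒᵖ V]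
  [SMulCommClass ℍ[ℝ]ᵐᵒᵖ ℍ[ℝ] V]
  [NormSMulClass ℍ[ℝ] V] [NormSMulClass ℍ[ℝ]ᵐᵒᵖ V]

/-- A bounded right linear operator, viewed as a bounded real linear operator. -/
def toReal : (V →L[ℍ[ℝ]ᵐᵒᵖ] V) →+* (V →L[ℝ] V) where
  toFun T := T.restrictScalars ℝ
  map_one' := rfl
  map_mul' _ _ := rfl
  map_zero' := rfl
  map_add' _ _ := rfl

theorem toReal_injective :
    Function.Injective (toReal : (V →L[ℍ[ℝ]ᵐᵒᵖ] V) →+* (V →L[ℝ] V)) := by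
  intro S T h
  ext v
  exact DFunLike.congr_fun h v

/-- `toReal` as a real linear map. -/
def toRealLin : (V →L[ℍ[ℝ]ᵐᵒᵖ] V) →ₗ[ℝ] (V →L[ℝ] V) where
  toFun T := toReal T
  map_add' _ _ := rfl
  map_smul' _ _ := rfl

/-- The ring of bounded right linear operators with the operator norm
`sup {‖T v‖ : ‖v‖ ≤ 1}`. -/
instance : NormedRing (V →L[ℍ[ℝ]ᵐᵒᵖ] V) :=
  NormedRing.induced (V →L[ℍ[ℝ]ᵐᵒᵖ] V) (V →L[ℝ] V) toReal toReal_injective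

instance : NormedSpace ℝ (V →L[ℍ[ℝ]ᵐᵒᵖ] V) :=
  NormedSpace.induced ℝ (V →L[ℍ[ℝ]ᵐᵒᵖ] V) (V →L[ℝ] V) toRealLin

theorem norm_eq (T : V →L[ℍ[ℝ]ᵐᵒᵖ] V) : ‖T‖ = ‖T.restrictScalars ℝ‖ := rfl

instance [CompleteSpace V] : CompleteSpace (V →L[ℍ[ℝ]ᵐᵒᵖ] V) := by
  have hiso : Isometry (toReal : (V →L[ℍ[ℝ]ᵐᵒᵖ] V) → (V →L[ℝ] V)) :=
    Isometry.of_dist_eq fun _ _ => rfl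
  have hr : Set.range (toReal : (V →L[ℍ[ℝ]ᵐᵒᵖ] V) → (V →L[ℝ] V))
      = ⋂ (a : ℍ[ℝ]ᵐᵒᵖ) (v : V), {A : V →L[ℝ] V | A (a • v) = a • A v} := by
    ext A
    simp only [Set.mem_range, Set.mem_iInter, Set.mem_ofPred_eq]
    constructor
    · rintro ⟨T, rfl⟩ a v
      exact T.map_smul a v
    · intro h
      exact ⟨{ toFun := A, map_add' := A.map_add, map_smul' := h, cont := A.cont },
        by ext v; rfl⟩
  have hc : IsClosed (Set.range (toReal : (V →L[ℍ[ℝ]ᵐᵒᵖ] V) → (V →L[ℝ] V))) := by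
    rw [hr]
    refine isClosed_iInter fun a => isClosed_iInter fun v => isClosed_eq ?_ ?_
    · exact (ContinuousLinearMap.apply ℝ V (a • v)).continuous
    · exact (ContinuousLinearMap.apply ℝ V v).continuous.const_smul a
  exact (completeSpace_iff_isComplete_range hiso.isUniformInducing).2 hc.isComplete

/-- The operator `a 𝓘 : v ↦ a v`. Since `(T a) v = T (a v)`, the product `T a` of an operator
with a quaternion on the right is `T * scalarOp a`. -/
def scalarOp (a : ℍ[ℝ]) : V →L[ℍ[ℝ]ᵐᵒᵖ] V := a • (1 : V →L[ℍ[ℝ]ᵐᵒᵖ] V)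

theorem scalarOp_apply (a : ℍ[ℝ]) (v : V) : (scalarOp a : V →L[ℍ[ℝ]ᵐᵒᵖ] V) v = a • v := rfl

/-- `T² - 2 Re[s] T + |s|² 𝓘`. -/
def quadOp (T : V →L[ℍ[ℝ]ᵐᵒᵖ] V) (s : ℍ[ℝ]) : V →L[ℍ[ℝ]ᵐᵒᵖ] V :=
  T ^ 2 - (2 * s.re) • T + (‖s‖ ^ 2) • (1 : V →L[ℍ[ℝ]ᵐᵒᵖ] V)

/-- The `S`-spectrum. -/
def sSpectrum (T : V →L[ℍ[ℝ]ᵐᵒᵖ] V) : Set ℍ[ℝ] := {s | ¬ IsUnit (quadOp T s)}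

/-- The `S`-resolvent operator `-(T² - 2 Re[s] T + |s|² 𝓘)⁻¹ (T - s̄ 𝓘)`
(meaningful for `s` outside the `S`-spectrum). -/
def sResolvent (s : ℍ[ℝ]) (T : V →L[ℍ[ℝ]ᵐᵒᵖ] V) : V →L[ℍ[ℝ]ᵐᵒᵖ] V :=
  -(Ring.inverse (quadOp T s) * (T - scalarOp (star s)))

end Operators

/-! ## Boundaries of plane open sets and the Cauchy integral -/

/-- The positively oriented boundary `∂U` of a plane open set `U`: finitely many closed rectifiable
curves (with Lipschitz parametrizations on `[0, 1]`) whose traces together make up the topological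
boundary of `U`, and whose total winding number is `1` about each point of `U` and `0` about each
point outside the closure of `U`. -/
structure OrientedBoundary (U : Set ℂ) where
  /-- the number of curves -/
  n : ℕ
  /-- the curves -/
  γ : Fin n → ℝ → ℂ
  lipschitz : ∀ k, ∃ K, LipschitzOnWith K (γ k) (Icc 0 1)
  closed : ∀ k, γ k 0 = γ k 1
  trace : ⋃ k, γ k '' Icc 0 1 = frontier U
  index_inside : ∀ a ∈ U,
    (2 * Real.pi * Complex.I)⁻¹ * ∑ k, ∫ t in (0 : ℝ)..1, (γ k t - a)⁻¹ * deriv (γ k) t = 1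
  index_outside : ∀ a ∉ closure U,
    (2 * Real.pi * Complex.I)⁻¹ * ∑ k, ∫ t in (0 : ℝ)..1, (γ k t - a)⁻¹ * deriv (γ k) t = 0

section Integral

variable {V : Type*} [NormedAddCommGroup V] [NormedSpace ℝ V]
  [Module ℍ[ℝ] V] [Module ℍ[ℝ]ᵐᵒᵖ V]
  [IsScalarTower ℝ ℍ[ℝ] V] [IsScalarTower ℝ ℍ[ℝ]ᵐᵒᵖ V]
  [SMulCommClass ℍ[ℝ]ᵐᵒᵖ ℍ[ℝ] V]
  [NormSMulClass ℍ[ℝ] V] [NormSMulClass ℍ[ℝ]ᵐᵒᵖ V]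

/-- `U`, read as the subset `{x + I y | x + i y ∈ U}` of the slice `L_I`, is a bounded open set
which contains `L_I ∩ σ_S(T)` and whose closure lies in the ball `B(0, R)`. -/
structure IsAdmissible (T : V →L[ℍ[ℝ]ᵐᵒᵖ] V) (R : ℝ) (I : ℍ[ℝ]) (U : Set ℂ) : Prop where
  isOpen : IsOpen U
  isBounded : Bornology.IsBounded U
  spectrum_subset : ∀ z, slice I z ∈ sSpectrum T → z ∈ U
  closure_subset : ∀ z ∈ closure U, slice I z ∈ ball (0 : ℍ[ℝ]) R

/-- The pull-back of `S⁻¹(s, T) ds_I f(s)`, where `ds_I = -I ds`, along the curve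
`s = x(t) + I y(t)` in `L_I` with `γ t = x(t) + i y(t)`. -/
def cauchyIntegrand (T : V →L[ℍ[ℝ]ᵐᵒᵖ] V) (f : ℍ[ℝ] → ℍ[ℝ]) (I : ℍ[ℝ]) (γ : ℝ → ℂ) (t : ℝ) :
    V →L[ℍ[ℝ]ᵐᵒᵖ] V :=
  sResolvent (slice I (γ t)) T * scalarOp ((-I * slice I (deriv γ t)) * f (slice I (γ t)))

/-- `(1 / 2π) ∫_{∂U} S⁻¹(s, T) ds_I f(s)`. -/
def cauchyIntegral (T : V →L[ℍ[ℝ]ᵐᵒᵖ] V) (f : ℍ[ℝ] → ℍ[ℝ]) (I : ℍ[ℝ]) {U : Set ℂ}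
    (Γ : OrientedBoundary U) : V →L[ℍ[ℝ]ᵐᵒᵖ] V :=
  (1 / (2 * Real.pi)) • ∑ k, ∫ t in (0 : ℝ)..1, cauchyIntegrand T f I (Γ.γ k) t

end Integral

end SCalculus

end

noncomputable section

namespace SCalculus

open Filter Topology

/-! ## Lipschitz curves -/

section Curves

variable {γ : ℝ → ℂ} {K : NNReal}

/-! On each slice the regular `f` is holomorphic for left multiplication by `I`, hence `f(s) = ∑ sⁿ
aₙ`. The `aₙ` are determined on the real axis, which all slices share, so they do not depend on `I`
(`IsLeftRegularOn.exists_hasSum`). Integrating termwise, the Cauchy integral equals `∑ Tⁿ aₙ`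
(`IsAdmissible.hasSum_cauchyIntegral`), where neither `I` nor `U` occurs.

The monomial case is classical Riesz–Dunford calculus in disguise. Let `x + iy` act on the operators
by right multiplication by `x + Iy`; then `L : A ↦ T A` is complex linear. Unlike `s` and `T`, the
scalar `z` and `L` commute, so `T² - 2 Re[s] T + |s|²` acts as `(z - L)(z̄ - L)` (`leftMul_quadOp`).
Hence the spectrum of `L` lies in the slice of the `S`-spectrum, and `S⁻¹(s, T)` is the resolvent of
`L` at `z` applied to the identity (`resolvent_leftMul_one`).

Boundaries are known only through winding numbers. Instead of deforming contours,
`integral_resolvent` extends a Cauchy transform to an entire function and applies Liouville's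
theorem; higher powers follow by induction. -/

theorem norm_deriv_le_of_mem_Ioo (hγ : LipschitzOnWith K γ (Icc 0 1)) {t : ℝ}
    (ht : t ∈ Ioo (0 : ℝ) 1) : ‖deriv γ t‖ ≤ K :=
  norm_deriv_le_of_lipschitzOn (Icc_mem_nhds ht.1 ht.2) hγ

/-- At the endpoints `deriv γ` depends on values of `γ` outside `[0, 1]`, about which nothing is
known; discarding this null set keeps only points where the Lipschitz bound controls it. -/
theorem ae_mem_Ioo : ∀ᵐ t : ℝ, t ∈ Set.uIoc (0 : ℝ) 1 → t ∈ Ioo (0 : ℝ) 1 := by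
  have h : ∀ᵐ t : ℝ, t ≠ 1 := by simp [ae_iff, measure_singleton]
  filter_upwards [h] with t ht htm
  rw [uIoc_of_le zero_le_one] at htm
  exact ⟨htm.1, lt_of_le_of_ne htm.2 ht⟩

theorem intervalIntegrable_deriv (hγ : LipschitzOnWith K γ (Icc 0 1)) :
    IntervalIntegrable (deriv γ) volume 0 1 := by
  refine (intervalIntegrable_const (c := (K : ℝ))).mono_fun
    (measurable_deriv γ).aestronglyMeasurable ?_
  rw [EventuallyLE, ae_restrict_iff' measurableSet_uIoc]
  filter_upwards [ae_mem_Ioo] with t h ht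
  simpa using norm_deriv_le_of_mem_Ioo hγ (h ht)

theorem ae_differentiableAt (hγ : LipschitzOnWith K γ (Icc 0 1)) :
    ∀ᵐ t : ℝ, t ∈ Set.uIoc (0 : ℝ) 1 → DifferentiableAt ℝ γ t := by
  filter_upwards [hγ.ae_differentiableWithinAt_of_mem_real, ae_mem_Ioo] with t h1 h2 ht
  have ht' := h2 ht
  exact (h1 (Ioo_subset_Icc_self ht')).differentiableAt (Icc_mem_nhds ht'.1 ht'.2)

/-- The fundamental theorem of calculus for complex valued Lipschitz functions. -/
theorem integral_deriv_eq_sub (hγ : LipschitzOnWith K γ (Icc 0 1)) :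
    ∫ t in (0 : ℝ)..1, deriv γ t = γ 1 - γ 0 := by
  -- A real functional reduces the claim to absolutely continuous real functions; `re` and `im` then
  -- recover the complex identity.
  have key : ∀ ℓ : ℂ →L[ℝ] ℝ, ℓ (∫ t in (0 : ℝ)..1, deriv γ t) = ℓ (γ 1 - γ 0) := by
    intro ℓ
    rw [← ℓ.intervalIntegral_comp_comm (intervalIntegrable_deriv hγ), map_sub]
    have hl : LipschitzOnWith (‖ℓ‖₊ * K) (fun t => ℓ (γ t)) (uIcc 0 1) := by
      rw [uIcc_of_le zero_le_one]
      exact ℓ.lipschitz.comp_lipschitzOnWith hγ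
    rw [← hl.absolutelyContinuousOnInterval.integral_deriv_eq_sub]
    refine intervalIntegral.integral_congr_ae ?_
    filter_upwards [ae_differentiableAt hγ] with t h ht
    exact ((ℓ.hasFDerivAt.comp_hasDerivAt t (h ht).hasDerivAt).deriv).symm
  exact Complex.ext (key Complex.reCLM) (key Complex.imCLM)

/-- The integrand has primitive `γ ^ (n + 1) / (n + 1)`, which takes equal values at both ends. It
is again Lipschitz because the trace is compact. -/
theorem integral_deriv_mul_pow_eq_zero (hγ : LipschitzOnWith K γ (Icc 0 1)) (h01 : γ 0 = γ 1)
    (n : ℕ) : ∫ t in (0 : ℝ)..1, deriv γ t * γ t ^ n = 0 := by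
  have hc : IsCompact (γ '' Icc 0 1) := isCompact_Icc.image_of_continuousOn hγ.continuousOn
  obtain ⟨C, hC⟩ := LocallyLipschitzOn.exists_lipschitzOnWith_of_compact hc
    (contDiff_id.pow (n + 1) : ContDiff ℝ 1
      fun z : ℂ => z ^ (n + 1)).locallyLipschitz.locallyLipschitzOn
  have hp : LipschitzOnWith (C * K) (fun t => γ t ^ (n + 1)) (Icc 0 1) :=
    hC.comp hγ (mapsTo_image _ _)
  have h := integral_deriv_eq_sub hp
  rw [h01, sub_self] at h
  have h2 : ∫ t in (0 : ℝ)..1, deriv (fun t => γ t ^ (n + 1)) t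
      = ∫ t in (0 : ℝ)..1, (n + 1 : ℂ) * (deriv γ t * γ t ^ n) := by
    refine intervalIntegral.integral_congr_ae ?_
    filter_upwards [ae_differentiableAt hγ] with t h ht
    rw [((h ht).hasDerivAt.fun_pow (n + 1)).deriv]
    push_cast
    ring
  rw [h2, intervalIntegral.integral_const_mul] at h
  exact (mul_eq_zero.1 h).resolve_left (by exact_mod_cast Nat.succ_ne_zero n)

variable {E : Type*} [NormedAddCommGroup E] [NormedSpace ℂ E]

theorem intervalIntegrable_deriv_smul (hγ : LipschitzOnWith K γ (Icc 0 1)) {G : ℝ → E}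
    (hG : ContinuousOn G (Icc 0 1)) :
    IntervalIntegrable (fun t => deriv γ t • G t) volume 0 1 :=
  (intervalIntegrable_deriv hγ).smul_continuousOn (by rwa [uIcc_of_le zero_le_one])

/-- Differentiation under the integral: `z₀` has a ball of radius `ε` off the compact trace, so for
`z` in the ball of half the radius the kernel is bounded by `(ε / 2)⁻¹`. -/
theorem differentiableAt_cauchyTransform (hγ : LipschitzOnWith K γ (Icc 0 1)) {G : ℝ → E}
    (hG : ContinuousOn G (Icc 0 1)) {z₀ : ℂ} (hz₀ : z₀ ∉ γ '' Icc 0 1) :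
    DifferentiableAt ℂ
      (fun z => ∫ t in (0 : ℝ)..1, deriv γ t • (γ t - z)⁻¹ • G t) z₀ := by
  have hc : IsClosed (γ '' Icc 0 1) :=
    (isCompact_Icc.image_of_continuousOn hγ.continuousOn).isClosed
  obtain ⟨ε, hε, hball⟩ := Metric.isOpen_iff.1 hc.isOpen_compl z₀ hz₀
  have hfar : ∀ t ∈ Icc (0 : ℝ) 1, ∀ z ∈ ball z₀ (ε / 2), ε / 2 ≤ ‖γ t - z‖ := by
    intro t ht z hz
    by_contra! h
    refine @hball (γ t) ?_ (mem_image_of_mem _ ht)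
    calc dist (γ t) z₀ ≤ dist (γ t) z + dist z z₀ := dist_triangle _ _ _
      _ < ε / 2 + ε / 2 := add_lt_add (by rwa [dist_eq_norm]) hz
      _ = ε := by ring
  have hne : ∀ t ∈ Icc (0 : ℝ) 1, ∀ z ∈ ball z₀ (ε / 2), γ t - z ≠ 0 := fun t ht z hz h => by
    have := hfar t ht z hz
    rw [h, norm_zero] at this
    linarith
  obtain ⟨M, hM⟩ := isCompact_Icc.exists_bound_of_continuousOn hG
  have hcont : ∀ z ∈ ball z₀ (ε / 2), ContinuousOn (fun t => (γ t - z)⁻¹) (Icc 0 1) :=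
    fun z hz => (hγ.continuousOn.sub continuousOn_const).inv₀ fun t ht => hne t ht z hz
  have hz₀' : z₀ ∈ ball z₀ (ε / 2) := mem_ball_self (by positivity)
  refine (intervalIntegral.hasDerivAt_integral_of_dominated_loc_of_deriv_le (𝕜 := ℂ)
    (F' := fun z t => deriv γ t • ((γ t - z)⁻¹ ^ 2) • G t)
    (bound := fun _ => K * (((ε / 2)⁻¹) ^ 2 * M))
    (ball_mem_nhds z₀ (half_pos hε)) ?_ ?_ ?_ ?_ ?_ ?_).2.differentiableAt
  · filter_upwards [ball_mem_nhds z₀ (half_pos hε)] with z hz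
    exact (intervalIntegrable_iff.1
      (intervalIntegrable_deriv_smul hγ ((hcont z hz).smul hG))).aestronglyMeasurable
  · exact intervalIntegrable_deriv_smul hγ ((hcont z₀ hz₀').smul hG)
  · exact (intervalIntegrable_iff.1
      (intervalIntegrable_deriv_smul hγ (((hcont z₀ hz₀').pow 2).smul hG))).aestronglyMeasurable
  · filter_upwards [ae_mem_Ioo] with t h ht z hz
    have ht' := h ht
    have ht'' := Ioo_subset_Icc_self ht'
    rw [norm_smul, norm_smul, norm_pow, norm_inv]
    gcongr
    · exact norm_deriv_le_of_mem_Ioo hγ ht'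
    · exact hfar t ht'' z hz
    · exact hM t ht''
  · exact intervalIntegrable_const
  · filter_upwards [ae_mem_Ioo] with t h ht z hz
    have ht'' := Ioo_subset_Icc_self (h ht)
    have h1 : HasDerivAt (fun z => (γ t - z)⁻¹) ((γ t - z)⁻¹ ^ 2) z := by
      have := ((hasDerivAt_id z).const_sub (γ t)).inv (hne t ht'' z hz)
      convert! this using 1
      simp
    exact (h1.smul_const (G t)).const_smul (deriv γ t)

end Curves

/-! ## The Riesz–Dunford integral of a power -/

section Dunford

variable {A : Type*} [NormedRing A] [NormedAlgebra ℂ A]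

theorem resolvent_mul_sub {a : A} {z : ℂ} (hz : z ∈ resolventSet ℂ a) :
    resolvent a z * (algebraMap ℂ A z - a) = 1 :=
  Ring.inverse_mul_cancel _ hz

theorem sub_mul_resolvent {a : A} {z : ℂ} (hz : z ∈ resolventSet ℂ a) :
    (algebraMap ℂ A z - a) * resolvent a z = 1 :=
  Ring.mul_inverse_cancel _ hz

theorem integral_const_mul_of_intervalIntegrable {A : Type*} [NormedRing A] [NormedAlgebra ℝ A]
    [CompleteSpace A] {g : ℝ → A} (hg : IntervalIntegrable g volume 0 1) (a : A) :
    ∫ t in (0 : ℝ)..1, a * g t = a * ∫ t in (0 : ℝ)..1, g t :=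
  (ContinuousLinearMap.mul ℝ A a).intervalIntegral_comp_comm hg

theorem integral_mul_const_of_intervalIntegrable {A : Type*} [NormedRing A] [NormedAlgebra ℝ A]
    [CompleteSpace A] {g : ℝ → A} (hg : IntervalIntegrable g volume 0 1) (a : A) :
    ∫ t in (0 : ℝ)..1, g t * a = (∫ t in (0 : ℝ)..1, g t) * a :=
  ((ContinuousLinearMap.mul ℝ A).flip a).intervalIntegral_comp_comm hg

/-- The first resolvent identity. -/
theorem resolvent_sub_resolvent_eq {a : A} {z w : ℂ} (hz : z ∈ resolventSet ℂ a)
    (hw : w ∈ resolventSet ℂ a) :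
    resolvent a z - resolvent a w = (w - z) • (resolvent a w * resolvent a z) := by
  calc resolvent a z - resolvent a w
      = resolvent a w * ((algebraMap ℂ A w - a) - (algebraMap ℂ A z - a)) * resolvent a z := by
        rw [mul_sub, resolvent_mul_sub hw, sub_mul, one_mul, mul_assoc, sub_mul_resolvent hz,
          mul_one]
    _ = (w - z) • (resolvent a w * resolvent a z) := by
        rw [sub_sub_sub_cancel_right, ← map_sub, Algebra.algebraMap_eq_smul_one,
          mul_smul_comm, mul_one, smul_mul_assoc]

/-- This is `z R(z) = a R(z) + 1` times `zⁿ`. The last term is polynomial in `z` and so disappears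
on integration over a closed curve. -/
theorem pow_succ_smul_resolvent {a : A} {z : ℂ} (hz : z ∈ resolventSet ℂ a) (n : ℕ) :
    z ^ (n + 1) • resolvent a z = a * (z ^ n • resolvent a z) + z ^ n • (1 : A) := by
  have h := sub_mul_resolvent hz
  rw [Algebra.algebraMap_eq_smul_one, sub_mul, smul_mul_assoc, one_mul] at h
  rw [pow_succ, mul_smul, sub_eq_iff_eq_add.1 h, smul_add, mul_smul_comm, add_comm]

variable [CompleteSpace A]

theorem differentiableAt_resolvent {a : A} {z : ℂ} (hz : z ∈ resolventSet ℂ a) :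
    DifferentiableAt ℂ (resolvent a) z :=
  (spectrum.hasDerivAt_resolvent_const_left hz).differentiableAt

variable {U : Set ℂ} (Γ : OrientedBoundary U) {a : A}

namespace OrientedBoundary

theorem mem_frontier (k : Fin Γ.n) {t : ℝ} (ht : t ∈ Icc (0 : ℝ) 1) : Γ.γ k t ∈ frontier U := by
  rw [← Γ.trace]
  exact mem_iUnion.2 ⟨k, mem_image_of_mem _ ht⟩

theorem notMem (hU : IsOpen U) (k : Fin Γ.n) {t : ℝ} (ht : t ∈ Icc (0 : ℝ) 1) : Γ.γ k t ∉ U := by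
  have := Γ.mem_frontier k ht
  rw [hU.frontier_eq] at this
  exact this.2

theorem continuousOn (k : Fin Γ.n) : ContinuousOn (Γ.γ k) (Icc 0 1) :=
  (Γ.lipschitz k).choose_spec.continuousOn

theorem continuousOn_resolvent (hU : IsOpen U) (ha : spectrum ℂ a ⊆ U) (k : Fin Γ.n) :
    ContinuousOn (fun t => resolvent a (Γ.γ k t)) (Icc 0 1) := fun t ht =>
  (differentiableAt_resolvent (not_not.1 fun h => Γ.notMem hU k ht (ha h))).continuousAt.comp_continuousWithinAt
    (Γ.continuousOn k t ht)

end OrientedBoundary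

/-- With `P` the left side, `(1 - P) R(z)` extends across the spectrum by a Cauchy transform. The
resulting entire function vanishes at infinity, hence everywhere, and `R(z)` can be cancelled. -/
theorem integral_resolvent (hU : IsOpen U) (ha : spectrum ℂ a ⊆ U) :
    (2 * Real.pi * Complex.I)⁻¹ •
      ∑ k, ∫ t in (0 : ℝ)..1, deriv (Γ.γ k) t • resolvent a (Γ.γ k t) = 1 := by
  classical
  set c : ℂ := (2 * Real.pi * Complex.I)⁻¹
  set P : A := c • ∑ k, ∫ t in (0 : ℝ)..1, deriv (Γ.γ k) t • resolvent a (Γ.γ k t) with hP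
  choose K hK using Γ.lipschitz
  have hres : ∀ z ∉ U, z ∈ resolventSet ℂ a := fun z hz => not_not.1 fun h => hz (ha h)
  let H : ℂ → A := fun z =>
    c • ∑ k, ∫ t in (0 : ℝ)..1, deriv (Γ.γ k) t • (Γ.γ k t - z)⁻¹ • resolvent a (Γ.γ k t)
  have hHd : ∀ z ∈ U, DifferentiableAt ℂ H z := by
    intro z hz
    refine DifferentiableAt.const_smul (DifferentiableAt.fun_sum fun k _ => ?_) c
    refine differentiableAt_cauchyTransform (hK k) (Γ.continuousOn_resolvent hU ha k) ?_
    rintro ⟨t, ht, rfl⟩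
    exact Γ.notMem hU k ht hz
  -- By the resolvent identity, `(w - z)⁻¹ R(w) = (w - z)⁻¹ R(z) - R(w) R(z)`. Integrating over `w =
  -- γ t`, the first term gives `R(z)` by the winding number and the second `P R(z)`.
  have hH : ∀ z ∈ U, z ∈ resolventSet ℂ a → H z = (1 - P) * resolvent a z := by
    intro z hz hza
    have hne : ∀ k, ∀ t ∈ Icc (0 : ℝ) 1, Γ.γ k t - z ≠ 0 := fun k t ht h =>
      Γ.notMem hU k ht (sub_eq_zero.1 h ▸ hz)
    have h1 : ∀ k, ∫ t in (0 : ℝ)..1, deriv (Γ.γ k) t • (Γ.γ k t - z)⁻¹ • resolvent a (Γ.γ k t)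
        = (∫ t in (0 : ℝ)..1, (Γ.γ k t - z)⁻¹ * deriv (Γ.γ k) t) • resolvent a z
          - (∫ t in (0 : ℝ)..1, deriv (Γ.γ k) t • resolvent a (Γ.γ k t)) * resolvent a z := by
      intro k
      have hi1 : IntervalIntegrable (fun t => (Γ.γ k t - z)⁻¹ * deriv (Γ.γ k) t) volume 0 1 :=
        (intervalIntegrable_deriv (hK k)).continuousOn_smul (by
          rw [uIcc_of_le zero_le_one]
          exact ((Γ.continuousOn k).sub continuousOn_const).inv₀ (hne k))
      have hi2 := intervalIntegrable_deriv_smul (hK k) (Γ.continuousOn_resolvent hU ha k)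
      rw [← intervalIntegral.integral_smul_const, ← integral_mul_const_of_intervalIntegrable hi2,
        ← intervalIntegral.integral_sub]
      · refine intervalIntegral.integral_congr fun t ht => ?_
        rw [uIcc_of_le zero_le_one] at ht
        have := resolvent_sub_resolvent_eq hza (hres _ (Γ.notMem hU k ht))
        have h2 : (Γ.γ k t - z)⁻¹ • resolvent a (Γ.γ k t) = (Γ.γ k t - z)⁻¹ • resolvent a z
            - resolvent a (Γ.γ k t) * resolvent a z := by
          rw [eq_sub_iff_add_eq, ← eq_sub_iff_add_eq', ← smul_sub, this, smul_smul,
            inv_mul_cancel₀ (hne k t ht), one_smul]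
        simp only [h2, smul_sub, smul_smul, smul_mul_assoc, mul_comm]
      · exact hi1.smul_continuousOn continuousOn_const
      · exact hi2.mul_continuousOn continuousOn_const
    have h3 := Γ.index_inside z hz
    simp only [H, h1, Finset.sum_sub_distrib, smul_sub, ← Finset.sum_smul, ← Finset.sum_mul]
    rw [smul_smul, h3, one_smul, sub_mul, one_mul, hP, smul_mul_assoc]
  -- The open sets `U` and `resolventSet ℂ a` cover the plane since the spectrum lies in `U`, and
  -- the two formulas agree on the overlap, so `F` is entire.
  let F : ℂ → A := fun z => if z ∈ U then H z else (1 - P) * resolvent a z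
  have hFρ : ∀ z ∈ resolventSet ℂ a, F z = (1 - P) * resolvent a z := by
    intro z hz
    by_cases h : z ∈ U
    · simp only [F, if_pos h, hH z h hz]
    · simp only [F, if_neg h]
  have hFd : Differentiable ℂ F := by
    intro z
    by_cases h : z ∈ U
    · refine (hHd z h).congr_of_eventuallyEq ?_
      filter_upwards [hU.mem_nhds h] with w hw
      simp only [F, if_pos hw]
    · refine DifferentiableAt.congr_of_eventuallyEq
        ((differentiableAt_resolvent (hres z h)).const_mul (1 - P)) ?_
      filter_upwards [(spectrum.isOpen_resolventSet a).mem_nhds (hres z h)] with w hw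
      exact hFρ w hw
  have hunit := spectrum.eventually_isUnit_resolvent (𝕜 := ℂ) a
  have hlim : Tendsto F (cocompact ℂ) (𝓝 0) := by
    rw [← Metric.cobounded_eq_cocompact]
    have h : Tendsto (fun z => (1 - P) * resolvent a z) (Bornology.cobounded ℂ) (𝓝 0) := by
      simpa using (spectrum.resolvent_tendsto_cobounded (𝕜 := ℂ) a).const_mul (1 - P)
    refine h.congr' ?_
    filter_upwards [hunit] with z hz
    exact (hFρ z (spectrum.isUnit_resolvent.2 hz)).symm
  obtain ⟨z, hz⟩ := hunit.exists
  have h0 := hFd.apply_eq_of_tendsto_cocompact z hlim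
  rw [hFρ z (spectrum.isUnit_resolvent.2 hz)] at h0
  exact (sub_eq_zero.1 (hz.mul_left_eq_zero.1 h0)).symm

theorem integral_pow_smul_resolvent (hU : IsOpen U) (ha : spectrum ℂ a ⊆ U) (n : ℕ) :
    (2 * Real.pi * Complex.I)⁻¹ •
      ∑ k, ∫ t in (0 : ℝ)..1, deriv (Γ.γ k) t • Γ.γ k t ^ n • resolvent a (Γ.γ k t) = a ^ n := by
  choose K hK using Γ.lipschitz
  have hres : ∀ z ∉ U, z ∈ resolventSet ℂ a := fun z hz => not_not.1 fun h => hz (ha h)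
  induction n with
  | zero => simpa using integral_resolvent Γ hU ha
  | succ n ih =>
    have h1 : ∀ k, ∫ t in (0 : ℝ)..1, deriv (Γ.γ k) t • Γ.γ k t ^ (n + 1) • resolvent a (Γ.γ k t)
        = a * ∫ t in (0 : ℝ)..1, deriv (Γ.γ k) t • Γ.γ k t ^ n • resolvent a (Γ.γ k t) := by
      intro k
      have hi1 : IntervalIntegrable (fun t => deriv (Γ.γ k) t • Γ.γ k t ^ n • resolvent a (Γ.γ k t))
          volume 0 1 := intervalIntegrable_deriv_smul (hK k)
        (((Γ.continuousOn k).pow n).smul (Γ.continuousOn_resolvent hU ha k))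
      have hi2 : IntervalIntegrable (fun t => deriv (Γ.γ k) t • Γ.γ k t ^ n • (1 : A))
          volume 0 1 := intervalIntegrable_deriv_smul (hK k)
        (((Γ.continuousOn k).pow n).smul (continuousOn_const (c := (1 : A))))
      have h2 : ∫ t in (0 : ℝ)..1, deriv (Γ.γ k) t • Γ.γ k t ^ n • (1 : A) = 0 := by
        simp_rw [smul_smul]
        rw [intervalIntegral.integral_smul_const,
          integral_deriv_mul_pow_eq_zero (hK k) (Γ.closed k), zero_smul]
      rw [← integral_const_mul_of_intervalIntegrable hi1,
        ← add_zero (∫ t in (0 : ℝ)..1, a * (deriv (Γ.γ k) t • Γ.γ k t ^ n • resolvent a (Γ.γ k t))), ← h2,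
        ← intervalIntegral.integral_add (hi1.continuousOn_mul continuousOn_const) hi2]
      refine intervalIntegral.integral_congr fun t ht => ?_
      rw [uIcc_of_le zero_le_one] at ht
      simp only [pow_succ_smul_resolvent (hres _ (Γ.notMem hU k ht)) n, smul_add, mul_smul_comm]
    simp_rw [h1, ← Finset.mul_sum]
    rw [← mul_smul_comm, ih, pow_succ']

end Dunford

/-! ## Slices -/

theorem imagUnits_mul_self {I : ℍ[ℝ]} (hI : I ∈ imagUnits) : I * I = -1 := by
  have h1 : star I = -I := by rw [Quaternion.star_eq_neg]; exact hI.1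
  have h2 := Quaternion.self_mul_star I
  rw [h1, mul_neg, Quaternion.normSq_eq_norm_mul_self, hI.2] at h2
  rw [← neg_eq_iff_eq_neg, h2]
  simp

/-- The identification `ℂ ≃ L_I` as a homomorphism into the quaternions. -/
def sliceHom (I : imagUnits) : ℂ →ₐ[ℝ] ℍ[ℝ] :=
  Complex.liftAux (I : ℍ[ℝ]) (imagUnits_mul_self I.2)

theorem sliceHom_apply (I : imagUnits) (z : ℂ) : sliceHom I z = slice I z := by
  rw [sliceHom, Complex.liftAux_apply, slice, Quaternion.mul_coe_eq_smul]
  rfl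

theorem slice_ofReal (I : ℍ[ℝ]) (x : ℝ) : slice I (x : ℂ) = (x : ℍ[ℝ]) := by
  simp [slice]

theorem slice_I (I : ℍ[ℝ]) : slice I Complex.I = I := by
  simp [slice]

theorem star_slice (I : imagUnits) (z : ℂ) :
    star (slice I z) = slice I (starRingEnd ℂ z) := by
  have h1 : star (I : ℍ[ℝ]) = -I := by rw [Quaternion.star_eq_neg]; exact I.2.1
  simp only [slice, star_add, star_mul, Quaternion.star_coe, h1, Complex.conj_re, Complex.conj_im,
    Quaternion.coe_neg, mul_neg]
  rw [Quaternion.coe_commutes]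

theorem norm_slice (I : imagUnits) (z : ℂ) : ‖slice I z‖ = ‖z‖ := by
  have h := Quaternion.self_mul_star (slice (I : ℍ[ℝ]) z)
  rw [star_slice, ← sliceHom_apply, ← sliceHom_apply, ← map_mul, Complex.mul_conj,
    sliceHom_apply, slice_ofReal, sliceHom_apply, Quaternion.normSq_eq_norm_mul_self,
    Quaternion.coe_inj, Complex.normSq_eq_norm_sq, sq] at h
  exact ((mul_self_inj (norm_nonneg _) (norm_nonneg _)).1 h).symm

theorem re_slice (I : imagUnits) (z : ℂ) : (slice I z).re = z.re := by
  have h : (I : ℍ[ℝ]).re = 0 := I.2.1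
  simp [slice, Quaternion.re_mul, h]

theorem continuous_slice (I : imagUnits) : Continuous (slice I) := by
  have : slice (I : ℍ[ℝ]) = (sliceHom I).toLinearMap := by
    ext1 z; exact (sliceHom_apply I z).symm
  rw [this]
  exact LinearMap.continuous_of_finiteDimensional _

section Operators

set_option linter.unusedSectionVars false

variable {V : Type*} [NormedAddCommGroup V] [NormedSpace ℝ V]
  [Module ℍ[ℝ] V] [Module ℍ[ℝ]ᵐᵒᵖ V]
  [IsScalarTower ℝ ℍ[ℝ] V] [IsScalarTower ℝ ℍ[ℝ]ᵐᵒᵖ V]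
  [SMulCommClass ℍ[ℝ]ᵐᵒᵖ ℍ[ℝ] V]
  [NormSMulClass ℍ[ℝ] V] [NormSMulClass ℍ[ℝ]ᵐᵒᵖ V]

/-! ## Left multiplication by a quaternion -/

theorem norm_scalarOp_le (a : ℍ[ℝ]) : ‖(scalarOp a : V →L[ℍ[ℝ]ᵐᵒᵖ] V)‖ ≤ ‖a‖ := by
  rw [norm_eq]
  exact ContinuousLinearMap.opNorm_le_bound _ (norm_nonneg a) fun v => (norm_smul a v).le

theorem scalarOp_mul (a b : ℍ[ℝ]) :
    (scalarOp (a * b) : V →L[ℍ[ℝ]ᵐᵒᵖ] V) = scalarOp a * scalarOp b := by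
  ext v
  exact mul_smul a b v

theorem scalarOp_one : (scalarOp 1 : V →L[ℍ[ℝ]ᵐᵒᵖ] V) = 1 := by
  ext v
  exact one_smul _ v

theorem scalarOp_coe (r : ℝ) : (scalarOp (r : ℍ[ℝ]) : V →L[ℍ[ℝ]ᵐᵒᵖ] V) = r • 1 := by
  ext v
  change (r : ℍ[ℝ]) • v = r • v
  rw [← algebraMap_smul ℍ[ℝ] r v]
  rfl

/-- Left multiplication by quaternions as a bounded real linear map into the operators. -/
def scalarOpL : ℍ[ℝ] →L[ℝ] (V →L[ℍ[ℝ]ᵐᵒᵖ] V) :=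
  LinearMap.mkContinuous
    { toFun := scalarOp
      map_add' := fun a b => by ext v; exact add_smul a b v
      map_smul' := fun r a => by ext v; exact smul_assoc r a v } 1
    fun a => by simpa using norm_scalarOp_le a

theorem scalarOpL_apply (a : ℍ[ℝ]) : (scalarOpL a : V →L[ℍ[ℝ]ᵐᵒᵖ] V) = scalarOp a := rfl

instance : NormedAlgebra ℝ (V →L[ℍ[ℝ]ᵐᵒᵖ] V) where
  __ := (inferInstance : NormedSpace ℝ (V →L[ℍ[ℝ]ᵐᵒᵖ] V))
  __ := Algebra.ofModule (R := ℝ) (A := V →L[ℍ[ℝ]ᵐᵒᵖ] V) (fun r S T => rfl)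
    fun r S T => by
      ext v
      exact (toReal S).map_smul r (T v)

/-! ## The complex structure given by a slice -/

variable (V) in
/-- The bounded right linear operators, with the complex structure in which `x + i y` acts by
`A ↦ A (x + I y)`. -/
def SliceOp (_I : imagUnits) : Type _ := V →L[ℍ[ℝ]ᵐᵒᵖ] V

variable {I : imagUnits}

instance : NormedAddCommGroup (SliceOp V I) :=
  inferInstanceAs (NormedAddCommGroup (V →L[ℍ[ℝ]ᵐᵒᵖ] V))

instance [CompleteSpace V] : CompleteSpace (SliceOp V I) :=
  inferInstanceAs (CompleteSpace (V →L[ℍ[ℝ]ᵐᵒᵖ] V))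

/-- An operator as an element of the complex space `SliceOp V I`. -/
def SliceOp.of (I : imagUnits) (A : V →L[ℍ[ℝ]ᵐᵒᵖ] V) : SliceOp V I := A

/-- An element of `SliceOp V I` as an operator. -/
def SliceOp.val (A : SliceOp V I) : V →L[ℍ[ℝ]ᵐᵒᵖ] V := A

/-- Scalars act on the right so that composition with `T` on the left commutes with them. -/
instance : SMul ℂ (SliceOp V I) := ⟨fun z A => .of I (A.val * scalarOp (slice I z))⟩

theorem SliceOp.val_smul (z : ℂ) (A : SliceOp V I) :
    (z • A).val = A.val * scalarOp (slice I z) := rfl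

theorem SliceOp.val_injective : Function.Injective (SliceOp.val : SliceOp V I → _) := fun _ _ h => h

theorem SliceOp.val_add (A B : SliceOp V I) : (A + B).val = A.val + B.val := rfl

theorem SliceOp.norm_val (A : SliceOp V I) : ‖A.val‖ = ‖A‖ := rfl

instance : Module ℂ (SliceOp V I) where
  one_smul A := SliceOp.val_injective (by
    rw [SliceOp.val_smul, ← sliceHom_apply, map_one, scalarOp_one, mul_one])
  mul_smul z w A := SliceOp.val_injective (by
    simp only [SliceOp.val_smul]
    -- A right action reverses products; this is harmless because `ℂ` is commutative.
    rw [mul_comm z w, ← sliceHom_apply, map_mul, sliceHom_apply, sliceHom_apply, scalarOp_mul,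
      mul_assoc])
  smul_zero z := SliceOp.val_injective (zero_mul _)
  zero_smul A := SliceOp.val_injective (by
    rw [SliceOp.val_smul, ← sliceHom_apply, map_zero, ← scalarOpL_apply, map_zero]
    exact mul_zero _)
  smul_add z A B := SliceOp.val_injective (by
    simp only [SliceOp.val_smul, SliceOp.val_add, add_mul])
  add_smul z w A := SliceOp.val_injective (by
    simp only [SliceOp.val_smul, SliceOp.val_add]
    rw [← sliceHom_apply, map_add, ← scalarOpL_apply, map_add, mul_add]
    simp only [sliceHom_apply, scalarOpL_apply])

instance : NormedSpace ℂ (SliceOp V I) where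
  norm_smul_le z A := by
    rw [← SliceOp.norm_val, SliceOp.val_smul, mul_comm ‖z‖]
    refine (norm_mul_le _ _).trans (mul_le_mul le_rfl ?_ (norm_nonneg _) (norm_nonneg _))
    exact (norm_scalarOp_le _).trans (norm_slice I z).le

/-- The real structure inherited from `ℂ` is the original one because real quaternions act
centrally. -/
theorem SliceOp.val_real_smul (r : ℝ) (A : SliceOp V I) : (r • A).val = r • A.val := by
  change A.val * scalarOp (slice I (r : ℂ)) = _
  rw [slice_ofReal, scalarOp_coe, mul_smul_comm, mul_one]

theorem SliceOp.val_ofReal_smul (r : ℝ) (A : SliceOp V I) : ((r : ℂ) • A).val = r • A.val :=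
  SliceOp.val_real_smul r A

/-- Left multiplication by an operator is complex linear on `SliceOp V I`. -/
def leftMul (I : imagUnits) : (V →L[ℍ[ℝ]ᵐᵒᵖ] V) →+* (SliceOp V I →L[ℂ] SliceOp V I) where
  toFun T := LinearMap.mkContinuous
    { toFun := fun A => .of I (T * A.val)
      map_add' := fun A B => mul_add T A.val B.val
      map_smul' := fun z A => (mul_assoc T A.val (scalarOp (slice I z))).symm } ‖T‖
    fun A => norm_mul_le T A.val
  map_one' := by ext A : 1; exact one_mul A.val
  map_mul' S T := by ext A : 1; exact mul_assoc S T A.val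
  map_zero' := by ext A : 1; exact zero_mul A.val
  map_add' S T := by ext A : 1; exact add_mul S T A.val

theorem val_leftMul (T : V →L[ℍ[ℝ]ᵐᵒᵖ] V) (A : SliceOp V I) :
    (leftMul I T A).val = T * A.val := rfl

/-- Follows from `z + z̄ = 2 Re z`, `z z̄ = |z|²` and the commutation of complex scalars with left
multiplication by `T`. -/
theorem leftMul_quadOp (T : V →L[ℍ[ℝ]ᵐᵒᵖ] V) (z : ℂ) :
    leftMul I (quadOp T (slice I z)) =
      (algebraMap ℂ _ z - leftMul I T) * (algebraMap ℂ _ (starRingEnd ℂ z) - leftMul I T) := by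
  have hexp : (algebraMap ℂ (SliceOp V I →L[ℂ] SliceOp V I) z - leftMul I T)
        * (algebraMap ℂ _ (starRingEnd ℂ z) - leftMul I T)
      = leftMul I T * leftMul I T - (algebraMap ℂ _ ((2 * z.re : ℝ) : ℂ)) * leftMul I T
        + algebraMap ℂ _ ((‖z‖ ^ 2 : ℝ) : ℂ) := by
    rw [← Complex.add_conj, ← Complex.normSq_eq_norm_sq, ← Complex.mul_conj, map_add, map_mul,
      sub_mul, mul_sub, mul_sub, ← Algebra.commutes (starRingEnd ℂ z) (leftMul I T)]
    noncomm_ring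
  rw [hexp]
  ext A : 1
  refine SliceOp.val_injective ?_
  rw [val_leftMul, quadOp, re_slice, norm_slice]
  have happ : ((leftMul I T * leftMul I T - algebraMap ℂ _ ((2 * z.re : ℝ) : ℂ) * leftMul I T
      + algebraMap ℂ _ ((‖z‖ ^ 2 : ℝ) : ℂ)) A).val
      = T * (T * A.val) - (((2 * z.re : ℝ) : ℂ) • leftMul I T A).val
        + (((‖z‖ ^ 2 : ℝ) : ℂ) • A).val := rfl
  rw [happ, SliceOp.val_ofReal_smul, SliceOp.val_ofReal_smul, val_leftMul]
  simp only [add_mul, sub_mul, smul_mul_assoc, one_mul, pow_two, mul_assoc]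

/-- An invertible product of commuting factors has invertible factors. -/
theorem mem_resolventSet_leftMul {T : V →L[ℍ[ℝ]ᵐᵒᵖ] V} {z : ℂ} (hz : slice I z ∉ sSpectrum T) :
    z ∈ resolventSet ℂ (leftMul I T) := by
  have h : IsUnit (leftMul I (quadOp T (slice I z))) := (not_not.1 hz).map (leftMul I)
  rw [leftMul_quadOp] at h
  have hc : Commute (algebraMap ℂ (SliceOp V I →L[ℂ] SliceOp V I) z - leftMul I T)
      (algebraMap ℂ _ (starRingEnd ℂ z) - leftMul I T) :=
    ((Algebra.commute_algebraMap_left _ _).sub_left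
      ((Algebra.commute_algebraMap_right _ _).sub_right (Commute.refl _)))
  exact (hc.isUnit_mul_iff.1 h).1

theorem spectrum_leftMul_subset {T : V →L[ℍ[ℝ]ᵐᵒᵖ] V} {U : Set ℂ}
    (hU : ∀ z, slice I z ∈ sSpectrum T → z ∈ U) : spectrum ℂ (leftMul I T) ⊆ U := fun z hz =>
  hU z (by_contra fun h => hz (mem_resolventSet_leftMul h))

/-- The `S`-resolvent operator is the resolvent of left multiplication by `T`, applied to the
identity. -/
theorem resolvent_leftMul_one {T : V →L[ℍ[ℝ]ᵐᵒᵖ] V} {z : ℂ} (hz : slice I z ∉ sSpectrum T) :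
    (resolvent (leftMul I T) z (.of I 1)).val = sResolvent (slice I z) T := by
  have hq : IsUnit (quadOp T (slice I z)) := not_not.1 hz
  have hD := mem_resolventSet_leftMul hz
  set D' : SliceOp V I →L[ℂ] SliceOp V I :=
    algebraMap ℂ _ (starRingEnd ℂ z) - leftMul I T with hD'
  have hc : Commute (algebraMap ℂ (SliceOp V I →L[ℂ] SliceOp V I) z - leftMul I T) D' :=
    ((Algebra.commute_algebraMap_left _ _).sub_left
      ((Algebra.commute_algebraMap_right _ _).sub_right (Commute.refl _)))
  have h : resolvent (leftMul I T) z = leftMul I (Ring.inverse (quadOp T (slice I z))) * D' := by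
    calc resolvent (leftMul I T) z
        = leftMul I (Ring.inverse (quadOp T (slice I z)) * quadOp T (slice I z))
            * resolvent (leftMul I T) z := by
          rw [Ring.inverse_mul_cancel _ hq, map_one, one_mul]
      _ = leftMul I (Ring.inverse (quadOp T (slice I z))) * D' := by
          rw [map_mul, leftMul_quadOp, ← hD', hc.eq, mul_assoc, mul_assoc, sub_mul_resolvent hD,
            mul_one]
  -- At the identity the factor `z̄ - L` becomes `s̄ - T`, which accounts for the minus sign in
  -- `sResolvent`.
  have happ : ((leftMul I (Ring.inverse (quadOp T (slice I z))) * D') (.of I 1)).val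
      = Ring.inverse (quadOp T (slice I z)) *
        (1 * scalarOp (slice I (starRingEnd ℂ z)) - T * 1) := rfl
  rw [h, happ, sResolvent, star_slice, ← mul_neg, neg_sub, one_mul, mul_one]

end Operators

/-! ## Power series of regular functions -/

/-- The quaternions, with the complex structure in which `x + i y` acts by left multiplication by
`x + I y`. -/
def SliceQuat (_I : imagUnits) : Type := ℍ[ℝ]

namespace SliceQuat

variable {I : imagUnits}

instance : NormedAddCommGroup (SliceQuat I) := inferInstanceAs (NormedAddCommGroup ℍ[ℝ])

instance : CompleteSpace (SliceQuat I) := inferInstanceAs (CompleteSpace ℍ[ℝ])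

instance : Module ℂ (SliceQuat I) := Module.compHom ℍ[ℝ] (sliceHom I).toRingHom

/-- A quaternion as an element of the complex space `SliceQuat I`. -/
def of (I : imagUnits) (q : ℍ[ℝ]) : SliceQuat I := q

/-- An element of `SliceQuat I` as a quaternion. -/
def val (q : SliceQuat I) : ℍ[ℝ] := q

theorem val_smul (z : ℂ) (q : SliceQuat I) : (z • q).val = slice I z * q.val := by
  rw [← sliceHom_apply]
  rfl

instance : NormedSpace ℂ (SliceQuat I) where
  norm_smul_le z q := by
    change ‖(z • q).val‖ ≤ ‖z‖ * ‖q.val‖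
    rw [val_smul, norm_mul, norm_slice]

theorem val_real_smul (r : ℝ) (q : SliceQuat I) : (r • q).val = r • q.val := by
  change ((r : ℂ) • q).val = _
  rw [val_smul, slice_ofReal, Quaternion.coe_mul_eq_smul]

variable (I) in
/-- `SliceQuat.of` as a bounded real linear map. -/
def ofL : ℍ[ℝ] →L[ℝ] SliceQuat I :=
  LinearMap.mkContinuous
    { toFun := of I
      map_add' := fun _ _ => rfl
      map_smul' := fun r q => (val_real_smul r (of I q)).symm } 1
    fun q => (one_mul ‖q‖).ge

variable (I) in
/-- `SliceQuat.val` as a bounded real linear map. -/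
def valL : SliceQuat I →L[ℝ] ℍ[ℝ] :=
  LinearMap.mkContinuous
    { toFun := val
      map_add' := fun _ _ => rfl
      map_smul' := fun r q => val_real_smul r q } 1
    fun q => (one_mul ‖q‖).ge

end SliceQuat

/-- `slice I` as a bounded real linear map. -/
def sliceL (I : imagUnits) : ℂ →L[ℝ] ℍ[ℝ] :=
  ⟨(sliceHom I).toLinearMap, by
    have h : ⇑(sliceHom I).toLinearMap = slice (I : ℍ[ℝ]) := funext (sliceHom_apply I)
    change Continuous ⇑(sliceHom I).toLinearMap
    rw [h]
    exact continuous_slice I⟩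

theorem sliceL_apply (I : imagUnits) (z : ℂ) : sliceL I z = slice I z := sliceHom_apply I z

theorem mem_ball_iff_norm_slice (I : imagUnits) {z : ℂ} {R : ℝ} :
    slice I z ∈ ball (0 : ℍ[ℝ]) R ↔ ‖z‖ < R := by
  rw [mem_ball_zero_iff, norm_slice]

/-- The Cauchy–Riemann equation says that the real differential `D` satisfies `D i = I · D 1`, which
is complex linearity for left multiplication by the slice. -/
theorem IsLeftRegularOn.differentiableOn_slice {f : ℍ[ℝ] → ℍ[ℝ]} {R : ℝ}
    (hf : IsLeftRegularOn f (ball 0 R)) (I : imagUnits) :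
    DifferentiableOn ℂ (fun z => SliceQuat.of I (f (slice I z))) (ball 0 R) := by
  intro z hz
  refine DifferentiableAt.differentiableWithinAt ?_
  have hz' : slice I z ∈ ball (0 : ℍ[ℝ]) R :=
    (mem_ball_iff_norm_slice I).2 (mem_ball_zero_iff.1 hz)
  have hfd : DifferentiableAt ℝ f (sliceL I z) := by
    rw [sliceL_apply]
    exact hf.1.differentiableAt (isOpen_ball.mem_nhds hz')
  have hd : HasFDerivAt (fun w => f (slice I w)) ((fderiv ℝ f (sliceL I z)).comp (sliceL I)) z := by
    have h := hfd.hasFDerivAt.comp z (sliceL I).hasFDerivAt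
    refine h.congr_of_eventuallyEq (Eventually.of_forall fun w => ?_)
    simp only [Function.comp, sliceL_apply]
  set D := (fderiv ℝ f (sliceL I z)).comp (sliceL I)
  have hx : HasDerivAt (fun x' : ℝ => f (slice I ⟨x', z.im⟩)) (D 1) z.re := by
    have h1 : HasDerivAt (fun x' : ℝ => (⟨x', z.im⟩ : ℂ)) 1 z.re := by
      have := (Complex.ofRealCLM.hasDerivAt (x := z.re)).add_const (⟨0, z.im⟩ : ℂ)
      refine (this.congr_of_eventuallyEq (Eventually.of_forall fun x' => ?_)).congr_deriv ?_
      · apply Complex.ext <;> simp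
      · simp
    exact HasFDerivAt.comp_hasDerivAt (x := z.re) (l := fun w => f (slice I w)) (hl := hd) (hf := h1)
  have hy : HasDerivAt (fun y' : ℝ => f (slice I ⟨z.re, y'⟩)) (D Complex.I) z.im := by
    have h1 : HasDerivAt (fun y' : ℝ => (⟨z.re, y'⟩ : ℂ)) Complex.I z.im := by
      have := ((Complex.ofRealCLM.hasDerivAt (x := z.im)).mul_const Complex.I).const_add (z.re : ℂ)
      refine (this.congr_of_eventuallyEq (Eventually.of_forall fun x' => ?_)).congr_deriv ?_
      · apply Complex.ext <;> simp
      · simp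
    exact HasFDerivAt.comp_hasDerivAt (x := z.im) (l := fun w => f (slice I w)) (hl := hd) (hf := h1)
  have hCR := hf.2 I I.2 z.re z.im hz'
  rw [hx.deriv, hy.deriv] at hCR
  have hCR' : D Complex.I = (I : ℍ[ℝ]) * D 1 := by
    have h := (smul_eq_zero.1 hCR).resolve_left (by norm_num)
    rw [eq_neg_of_add_eq_zero_left h, mul_neg, ← mul_assoc, imagUnits_mul_self I.2]
    simp
  have hd' : HasFDerivAt (fun w => SliceQuat.of I (f (slice I w))) ((SliceQuat.ofL I).comp D) z :=
    (SliceQuat.ofL I).hasFDerivAt.comp z hd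
  have h2 : ((SliceQuat.ofL I).comp D) Complex.I = Complex.I • ((SliceQuat.ofL I).comp D) 1 := by
    change D Complex.I = (Complex.I • SliceQuat.of I (D 1)).val
    rw [SliceQuat.val_smul, slice_I, hCR']
    rfl
  exact ((hasFDerivWithinAt_univ.2 hd').complexOfReal h2).differentiableWithinAt.differentiableAt
    univ_mem

/-- On each slice a regular function is the sum of a power series with right coefficients. -/
theorem IsLeftRegularOn.exists_hasSum_slice {f : ℍ[ℝ] → ℍ[ℝ]} {R : ℝ}
    (hf : IsLeftRegularOn f (ball 0 R)) (I : imagUnits) :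
    ∃ a : ℕ → ℍ[ℝ], ∀ z : ℂ, ‖z‖ < R →
      HasSum (fun n => slice I z ^ n * a n) (f (slice I z)) := by
  refine ⟨fun n => ((n.factorial : ℂ)⁻¹ •
    iteratedDeriv n (fun z => SliceQuat.of I (f (slice I z))) 0).val, fun z hz => ?_⟩
  have h := Complex.hasSum_taylorSeries_on_ball (hf.differentiableOn_slice I)
    (mem_ball_zero_iff.2 hz)
  have hv := (SliceQuat.valL I).hasSum h
  have hterm : ∀ n : ℕ, ∀ q : SliceQuat I, SliceQuat.valL I
      ((n.factorial : ℂ)⁻¹ • (z - 0) ^ n • q) = slice I z ^ n * ((n.factorial : ℂ)⁻¹ • q).val := by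
    intro n q
    rw [smul_comm, sub_zero, ← sliceHom_apply, ← map_pow, sliceHom_apply]
    exact SliceQuat.val_smul _ _
  simp only [hterm] at hv
  exact hv

/-- Used on the real axis, this identifies the coefficients coming from different slices. -/
theorem coeff_unique {E : Type*} [NormedAddCommGroup E] [NormedSpace ℝ E] {R : ℝ} (hR : 0 < R)
    {a b : ℕ → E} {g : ℝ → E} (ha : ∀ x : ℝ, |x| < R → HasSum (fun n => x ^ n • a n) (g x))
    (hb : ∀ x : ℝ, |x| < R → HasSum (fun n => x ^ n • b n) (g x)) : a = b := by
  let p : (ℕ → E) → FormalMultilinearSeries ℝ ℝ E := fun c n =>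
    ContinuousMultilinearMap.mkPiRing ℝ (Fin n) (c n)
  have hp : ∀ c n, (p c).coeff n = c n := fun c n => by
    simp [p, FormalMultilinearSeries.coeff]
  have key : ∀ c : ℕ → E, (∀ x : ℝ, |x| < R → HasSum (fun n => x ^ n • c n) (g x)) →
      HasFPowerSeriesAt g (p c) 0 := by
    intro c hc
    rw [hasFPowerSeriesAt_iff]
    filter_upwards [ball_mem_nhds (0 : ℝ) hR] with x hx
    simpa [hp] using hc x (by simpa using hx)
  have h := (key a ha).eq_formalMultilinearSeries (key b hb)
  funext n
  rw [← hp a n, h, hp]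

theorem IsLeftRegularOn.exists_hasSum {f : ℍ[ℝ] → ℍ[ℝ]} {R : ℝ} (hR : 0 < R)
    (hf : IsLeftRegularOn f (ball 0 R)) :
    ∃ a : ℕ → ℍ[ℝ], ∀ (I : imagUnits) (z : ℂ), ‖z‖ < R →
      HasSum (fun n => slice I z ^ n * a n) (f (slice I z)) := by
  choose a ha using fun I : imagUnits => hf.exists_hasSum_slice I
  have hreal : ∀ (I : imagUnits) (x : ℝ), |x| < R → HasSum (fun n => x ^ n • a I n) (f x) := by
    intro I x hx
    have h := ha I x (by simpa using hx)
    simp only [slice_ofReal, ← Quaternion.coe_pow, Quaternion.coe_mul_eq_smul] at h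
    exact h
  have hone : ∀ I J : imagUnits, a I = a J := fun I J => coeff_unique hR (hreal I) (hreal J)
  rcases isEmpty_or_nonempty imagUnits with h | ⟨⟨J⟩⟩
  · exact ⟨0, fun I => (h.false I).elim⟩
  · exact ⟨a J, fun I z hz => hone I J ▸ ha I z hz⟩

/-- Abel's argument: the terms are bounded at a radius `ρ` strictly between `r` and `R`, so at `r` a
geometric series of ratio `r / ρ` dominates. -/
theorem summable_norm_coeff {a : ℕ → ℍ[ℝ]} {I : imagUnits} {R r : ℝ} {g : ℂ → ℍ[ℝ]}
    (ha : ∀ z : ℂ, ‖z‖ < R → HasSum (fun n => slice I z ^ n * a n) (g z))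
    (hr0 : 0 ≤ r) (hr : r < R) : Summable fun n => r ^ n * ‖a n‖ := by
  obtain ⟨ρ, h1, h2⟩ := exists_between hr
  have hρ : 0 < ρ := hr0.trans_lt h1
  have hs := (ha ρ (by simpa [abs_of_pos hρ] using h2)).summable
  obtain ⟨C, hC⟩ := hs.tendsto_atTop_zero.norm.bddAbove_range
  have hC' : ∀ n, ρ ^ n * ‖a n‖ ≤ C := fun n => by
    simpa [norm_slice, abs_of_pos hρ] using hC (mem_range_self n)
  refine Summable.of_nonneg_of_le (fun n => by positivity) (fun n => ?_)
    ((summable_geometric_of_lt_one (div_nonneg hr0 hρ.le) ((div_lt_one hρ).2 h1)).mul_left C)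
  calc r ^ n * ‖a n‖ = (ρ ^ n * ‖a n‖) * (r / ρ) ^ n := by
        rw [div_pow]; field_simp
    _ ≤ C * (r / ρ) ^ n := by gcongr; exact hC' n

/-! ### Integrals over oriented boundaries and their power series -/

section Calculus

set_option linter.unusedSectionVars false

variable {V : Type*} [NormedAddCommGroup V] [NormedSpace ℝ V]
  [Module ℍ[ℝ] V] [Module ℍ[ℝ]ᵐᵒᵖ V]
  [IsScalarTower ℝ ℍ[ℝ] V] [IsScalarTower ℝ ℍ[ℝ]ᵐᵒᵖ V]
  [SMulCommClass ℍ[ℝ]ᵐᵒᵖ ℍ[ℝ] V]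
  [NormSMulClass ℍ[ℝ] V] [NormSMulClass ℍ[ℝ]ᵐᵒᵖ V]

variable {T : V →L[ℍ[ℝ]ᵐᵒᵖ] V} {f : ℍ[ℝ] → ℍ[ℝ]} {R : ℝ} {I : imagUnits} {U : Set ℂ}

/-- Evaluation at the identity operator. -/
def evalOne (I : imagUnits) : (SliceOp V I →L[ℂ] SliceOp V I) →L[ℝ] (V →L[ℍ[ℝ]ᵐᵒᵖ] V) :=
  LinearMap.mkContinuous
    { toFun := fun M => (M (.of I 1)).val
      map_add' := fun _ _ => rfl
      map_smul' := fun r M => SliceOp.val_real_smul r (M (.of I 1)) }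
    ‖SliceOp.of I (1 : V →L[ℍ[ℝ]ᵐᵒᵖ] V)‖
    fun M => by
      rw [mul_comm]
      exact M.le_opNorm _

theorem evalOne_smul (z : ℂ) (M : SliceOp V I →L[ℂ] SliceOp V I) :
    evalOne I (z • M) = evalOne I M * scalarOp (slice I z) := rfl

theorem evalOne_leftMul_pow (n : ℕ) : evalOne I (leftMul I T ^ n) = T ^ n := by
  rw [← map_pow]
  exact mul_one _

theorem evalOne_resolvent {z : ℂ} (hz : slice I z ∉ sSpectrum T) :
    evalOne I (resolvent (leftMul I T) z) = sResolvent (slice I z) T :=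
  resolvent_leftMul_one hz

/-- The pull-back of `S⁻¹(s, T) ds_I g` along a curve, with a function `g` of the parameter. -/
def curveIntegrand (T : V →L[ℍ[ℝ]ᵐᵒᵖ] V) (I : imagUnits) (γ : ℝ → ℂ) (g : ℝ → ℍ[ℝ]) (t : ℝ) :
    V →L[ℍ[ℝ]ᵐᵒᵖ] V :=
  sResolvent (slice I (γ t)) T * scalarOp ((-I * slice I (deriv γ t)) * g t)

theorem curveIntegrand_mul_const (γ : ℝ → ℂ) (g : ℝ → ℍ[ℝ]) (a : ℍ[ℝ]) (t : ℝ) :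
    curveIntegrand T I γ (fun t => g t * a) t = curveIntegrand T I γ g t * scalarOp a := by
  rw [curveIntegrand, curveIntegrand, ← mul_assoc, scalarOp_mul, ← mul_assoc]

variable [CompleteSpace V]

section Admissible

variable (hU : IsAdmissible T R I U) (Γ : OrientedBoundary U) (k : Fin Γ.n)
include hU

theorem IsAdmissible.notMem_sSpectrum {t : ℝ} (ht : t ∈ Icc (0 : ℝ) 1) :
    slice I (Γ.γ k t) ∉ sSpectrum T := fun h =>
  Γ.notMem hU.isOpen k ht (hU.spectrum_subset _ h)

theorem IsAdmissible.norm_lt {t : ℝ} (ht : t ∈ Icc (0 : ℝ) 1) : ‖Γ.γ k t‖ < R :=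
  (mem_ball_iff_norm_slice I).1
    (hU.closure_subset _ (frontier_subset_closure (Γ.mem_frontier k ht)))

theorem IsAdmissible.continuousOn_sResolvent :
    ContinuousOn (fun t => sResolvent (slice I (Γ.γ k t)) T) (Icc 0 1) := by
  have h := (evalOne (V := V) I).continuous.comp_continuousOn
    (Γ.continuousOn_resolvent hU.isOpen (spectrum_leftMul_subset hU.spectrum_subset) k)
  exact h.congr fun t ht => (evalOne_resolvent (hU.notMem_sSpectrum Γ k ht)).symm

/-- Only `deriv γ` may be discontinuous. Its real and imaginary parts are integrable and, being real
scalars, can be pulled out of the noncommutative product, leaving continuous factors. -/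
theorem IsAdmissible.intervalIntegrable_curveIntegrand {g : ℝ → ℍ[ℝ]}
    (hg : ContinuousOn g (Icc 0 1)) :
    IntervalIntegrable (curveIntegrand T I (Γ.γ k) g) volume 0 1 := by
  have hd := intervalIntegrable_deriv (Γ.lipschitz k).choose_spec
  have hre : IntervalIntegrable (fun t => (deriv (Γ.γ k) t).re) volume 0 1 :=
    ⟨hd.1.re, hd.2.re⟩
  have him : IntervalIntegrable (fun t => (deriv (Γ.γ k) t).im) volume 0 1 :=
    ⟨hd.1.im, hd.2.im⟩
  have hc : ∀ q : ℍ[ℝ], ContinuousOn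
      (fun t => sResolvent (slice I (Γ.γ k t)) T * scalarOp (q * g t)) (uIcc 0 1) := by
    intro q
    rw [uIcc_of_le zero_le_one]
    exact (hU.continuousOn_sResolvent Γ k).mul
      (scalarOpL.continuous.comp_continuousOn (continuousOn_const.mul hg))
  have h := (hre.smul_continuousOn (hc (-I))).add (him.smul_continuousOn (hc (-I * I)))
  refine h.congr fun t _ => ?_
  have hq : (-I * slice I (deriv (Γ.γ k) t)) * g t
      = (deriv (Γ.γ k) t).re • (-I * g t) + (deriv (Γ.γ k) t).im • (-I * I * g t) := by
    rw [slice, mul_add, add_mul, Quaternion.mul_coe_eq_smul, ← mul_assoc,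
      Quaternion.mul_coe_eq_smul, smul_mul_assoc, smul_mul_assoc]
  simp only [curveIntegrand, ← scalarOpL_apply, hq, map_add, map_smul, mul_add, mul_smul_comm]

theorem IsAdmissible.intervalIntegrable_cauchyIntegrand
    (hf : ContinuousOn f (ball 0 R)) :
    IntervalIntegrable (cauchyIntegrand T f I (Γ.γ k)) volume 0 1 :=
  hU.intervalIntegrable_curveIntegrand Γ k (g := fun t => f (slice I (Γ.γ k t)))
    (hf.comp ((continuous_slice I).comp_continuousOn (Γ.continuousOn k)) fun _ ht =>
      (mem_ball_iff_norm_slice I).2 (hU.norm_lt Γ k ht))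

theorem IsAdmissible.continuousOn_slice_pow (n : ℕ) :
    ContinuousOn (fun t => slice I (Γ.γ k t) ^ n) (Icc 0 1) :=
  ((continuous_slice I).comp_continuousOn (Γ.continuousOn k)).pow n

/-- The functional calculus of a monomial. -/
theorem IsAdmissible.integral_pow (n : ℕ) :
    (1 / (2 * Real.pi)) • ∑ k, ∫ t in (0 : ℝ)..1,
      curveIntegrand T I (Γ.γ k) (fun t => slice I (Γ.γ k t) ^ n) t = T ^ n := by
  have hσ := spectrum_leftMul_subset hU.spectrum_subset
  have h := integral_pow_smul_resolvent Γ hU.isOpen hσ n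
  -- The `-I` of `ds_I` is the scalar `-i` of the slice structure; with `1 / 2π` it gives `(2πi)⁻¹`.
  have h1 : ∀ k, ∫ t in (0 : ℝ)..1,
      curveIntegrand T I (Γ.γ k) (fun t => slice I (Γ.γ k t) ^ n) t
      = evalOne I ((-Complex.I) • ∫ t in (0 : ℝ)..1,
          deriv (Γ.γ k) t • Γ.γ k t ^ n • resolvent (leftMul I T) (Γ.γ k t)) := by
    intro k
    rw [← intervalIntegral.integral_smul, ← (evalOne (V := V) I).intervalIntegral_comp_comm]
    · refine intervalIntegral.integral_congr fun t ht => ?_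
      rw [uIcc_of_le zero_le_one] at ht
      simp only [smul_smul]
      rw [evalOne_smul, evalOne_resolvent (hU.notMem_sSpectrum Γ k ht), curveIntegrand]
      simp only [← sliceHom_apply, map_mul, map_neg, map_pow]
      rw [sliceHom_apply I Complex.I, slice_I, mul_assoc]
    · exact (intervalIntegrable_deriv_smul (Γ.lipschitz k).choose_spec
        (((Γ.continuousOn k).pow n).smul (Γ.continuousOn_resolvent hU.isOpen hσ k))).smul (-Complex.I)
  simp_rw [h1]
  rw [← map_sum, ← Finset.smul_sum, ← map_smul, ← evalOne_leftMul_pow (I := I) (T := T), ← h]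
  congr 1
  rw [← Complex.coe_smul, smul_smul]
  congr 1
  push_cast
  have : (Real.pi : ℂ) ≠ 0 := by exact_mod_cast Real.pi_ne_zero
  field_simp
  simp

theorem IsAdmissible.exists_norm_le :
    ∃ r, 0 ≤ r ∧ r < R ∧ ∀ t ∈ Icc (0 : ℝ) 1, ‖Γ.γ k t‖ ≤ r := by
  obtain ⟨t₀, ht₀, hmax⟩ := isCompact_Icc.exists_isMaxOn (nonempty_Icc.2 zero_le_one)
    (Γ.continuousOn k).norm
  exact ⟨_, norm_nonneg _, hU.norm_lt Γ k ht₀, hmax⟩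

/-- Dominated convergence: the compact trace stays within some radius `r < R`, and there `C K rⁿ
‖aₙ‖` is summable, with `C` bounding the `S`-resolvent and `K` the speed. -/
theorem IsAdmissible.hasSum_integral {a : ℕ → ℍ[ℝ]}
    (ha : ∀ z : ℂ, ‖z‖ < R → HasSum (fun n => slice I z ^ n * a n) (f (slice I z))) :
    HasSum (fun n => ∫ t in (0 : ℝ)..1,
        curveIntegrand T I (Γ.γ k) (fun t => slice I (Γ.γ k t) ^ n * a n) t)
      (∫ t in (0 : ℝ)..1, cauchyIntegrand T f I (Γ.γ k) t) := by
  obtain ⟨K, hK⟩ := Γ.lipschitz k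
  obtain ⟨r, hr0, hrR, hr⟩ := hU.exists_norm_le Γ k
  obtain ⟨C, hC⟩ := isCompact_Icc.exists_bound_of_continuousOn (hU.continuousOn_sResolvent Γ k)
  have hs := summable_norm_coeff ha hr0 hrR
  refine intervalIntegral.hasSum_integral_of_dominated_convergence
    (fun n _ => C * (K * (r ^ n * ‖a n‖))) (fun n => ?_) (fun n => ?_) ?_ ?_ ?_
  · exact (intervalIntegrable_iff.1 (hU.intervalIntegrable_curveIntegrand Γ k
      ((hU.continuousOn_slice_pow Γ k n).mul continuousOn_const))).aestronglyMeasurable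
  · filter_upwards [ae_mem_Ioo] with t h ht
    have ht' := h ht
    have ht'' := Ioo_subset_Icc_self ht'
    have hC0 : 0 ≤ C := (norm_nonneg _).trans (hC t ht'')
    refine (norm_mul_le _ _).trans
      (mul_le_mul (hC t ht'') ((norm_scalarOp_le _).trans ?_) (norm_nonneg _) hC0)
    rw [norm_mul, norm_mul, norm_mul, norm_pow, norm_neg, norm_slice, norm_slice, I.2.2, one_mul]
    gcongr
    · exact norm_deriv_le_of_mem_Ioo hK ht'
    · exact hr t ht''
  · exact Eventually.of_forall fun t _ => (hs.mul_left _).mul_left _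
  · exact intervalIntegrable_const
  · filter_upwards [ae_mem_Ioo] with t h ht
    have hsum := ha (Γ.γ k t) (hU.norm_lt Γ k (Ioo_subset_Icc_self (h ht)))
    exact ((scalarOpL (V := V)).hasSum (hsum.mul_left (-I * slice I (deriv (Γ.γ k) t)))).mul_left
      (sResolvent (slice I (Γ.γ k t)) T)

/-- The functional calculus of a power series. -/
theorem IsAdmissible.hasSum_cauchyIntegral {a : ℕ → ℍ[ℝ]}
    (ha : ∀ z : ℂ, ‖z‖ < R → HasSum (fun n => slice I z ^ n * a n) (f (slice I z))) :
    HasSum (fun n => T ^ n * scalarOp (a n)) (cauchyIntegral T f I Γ) := by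
  have h := (hasSum_sum fun k (_ : k ∈ Finset.univ) => hU.hasSum_integral Γ k ha).const_smul
    (1 / (2 * Real.pi))
  refine h.congr_fun fun n => ?_
  -- As `aₙ` stands to the right of `sⁿ`, it factors out of the integral on the right.
  rw [← hU.integral_pow Γ n, smul_mul_assoc, Finset.sum_mul]
  congr 1
  refine Finset.sum_congr rfl fun k _ => ?_
  simp only [curveIntegrand_mul_const]
  exact (integral_mul_const_of_intervalIntegrable
    (hU.intervalIntegrable_curveIntegrand Γ k (hU.continuousOn_slice_pow Γ k n)) _).symm

end Admissible

/-! ## Discs -/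

/-- The circle of radius `r` as the oriented boundary of a disc. -/
def circleBoundary {r : ℝ} (hr : 0 < r) : OrientedBoundary (ball (0 : ℂ) r) := by
  have hderiv : ∀ t : ℝ, HasDerivAt (fun t : ℝ => circleMap 0 r (2 * Real.pi * t))
      ((2 * Real.pi) • deriv (circleMap 0 r) (2 * Real.pi * t)) t := fun t => by
    have h := (hasDerivAt_circleMap (0 : ℂ) r (2 * Real.pi * t)).scomp t
      ((hasDerivAt_id t).const_mul (2 * Real.pi))
    rw [deriv_circleMap]
    simpa [Function.comp_def] using h
  -- The substitution `θ = 2πt` turns the winding integral into a standard circle integral.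
  have hint : ∀ a : ℂ, ∑ _k : Fin 1, ∫ t in (0 : ℝ)..1,
      (circleMap 0 r (2 * Real.pi * t) - a)⁻¹ *
        deriv (fun t : ℝ => circleMap 0 r (2 * Real.pi * t)) t = ∮ z in C(0, r), (z - a)⁻¹ := by
    intro a
    rw [Finset.sum_const, Finset.card_univ, Fintype.card_fin, one_smul, circleIntegral]
    have h := intervalIntegral.smul_integral_comp_mul_left (a := 0) (b := 1)
      (fun θ => deriv (circleMap 0 r) θ • (circleMap 0 r θ - a)⁻¹) (2 * Real.pi)
    rw [mul_zero, mul_one, ← intervalIntegral.integral_smul] at h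
    rw [← h]
    refine intervalIntegral.integral_congr fun t _ => ?_
    simp only [(hderiv t).deriv, smul_eq_mul, Complex.real_smul]
    ring
  exact
  { n := 1
    γ := fun _ t => circleMap 0 r (2 * Real.pi * t)
    lipschitz := fun _ => ⟨_, ((lipschitzWith_circleMap 0 r).comp
      (lipschitzWith_smul (2 * Real.pi))).lipschitzOnWith⟩
    closed := fun _ => by simp [circleMap]
    trace := by
      rw [iUnion_const, frontier_ball _ hr.ne']
      refine Subset.antisymm (image_subset_iff.2 fun t _ => circleMap_mem_sphere _ hr.le _) ?_
      rw [← abs_of_pos hr, ← image_circleMap_Ioc, abs_of_pos hr]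
      rintro _ ⟨θ, hθ, rfl⟩
      refine ⟨θ / (2 * Real.pi), ⟨div_nonneg hθ.1.le Real.two_pi_pos.le,
        (div_le_one Real.two_pi_pos).2 hθ.2⟩, ?_⟩
      simp only [mul_div_cancel₀ _ Real.two_pi_pos.ne']
    index_inside := fun a ha => by
      rw [hint, circleIntegral.integral_sub_inv_of_mem_ball ha, inv_mul_cancel₀]
      exact Complex.two_pi_I_ne_zero
    index_outside := fun a ha => by
      rw [closure_ball _ hr.ne'] at ha
      have hne : ∀ z ∈ closedBall (0 : ℂ) r, z - a ≠ 0 := fun z hz h =>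
        ha (sub_eq_zero.1 h ▸ hz)
      have h0 : ∮ z in C(0, r), (z - a)⁻¹ = 0 :=
        Complex.circleIntegral_eq_zero_of_differentiable_on_off_countable hr.le countable_empty
          (ContinuousOn.inv₀ (continuousOn_id.sub continuousOn_const) hne)
          fun z hz => (differentiableAt_id.sub_const a).inv (hne z (ball_subset_closedBall hz.1))
      rw [hint, h0, mul_zero] }

/-- Units are open in a complete normed ring, and `quadOp` is continuous along the slice. -/
theorem isClosed_sSpectrum_slice (T : V →L[ℍ[ℝ]ᵐᵒᵖ] V) (I : imagUnits) :
    IsClosed {z : ℂ | slice I z ∈ sSpectrum T} := by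
  have hc : Continuous fun z : ℂ => quadOp T (slice I z) := by
    simp only [quadOp, re_slice, norm_slice]
    exact (continuous_const.sub ((continuous_const.mul Complex.continuous_re).smul
      continuous_const)).add ((continuous_norm.pow 2).smul continuous_const)
  exact (Units.isOpen.preimage hc).isClosed_compl

/-- A closed subset of an open disc in the plane already lies in a smaller concentric disc, which
serves as `U`. -/
theorem exists_isAdmissible (hR : 0 < R) (hσ : sSpectrum T ⊆ ball 0 R) (I : imagUnits) :
    ∃ U : Set ℂ, IsAdmissible T R I U ∧ Nonempty (OrientedBoundary U) := by
  set S : Set ℂ := {z : ℂ | slice I z ∈ sSpectrum T} with hS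
  have hSR : S ⊆ ball 0 R := fun z hz =>
    mem_ball_zero_iff.2 ((mem_ball_iff_norm_slice I).1 (hσ hz))
  have hSc : IsClosed S := isClosed_sSpectrum_slice T I
  obtain ⟨r, hr, hrS⟩ : ∃ r ∈ Ioo 0 R, S ⊆ ball 0 r := exists_pos_lt_subset_ball hR hSc hSR
  refine ⟨ball 0 r, ⟨isOpen_ball, isBounded_ball, fun z hz => hrS hz, fun z hz => ?_⟩,
    ⟨circleBoundary hr.1⟩⟩
  have h := closure_ball_subset_closedBall hz
  exact (mem_ball_iff_norm_slice I).2 ((mem_closedBall_zero_iff.1 h).trans_lt hr.2)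

end Calculus

end SCalculus

end

theorem mainTheorem3 {V : Type*} [NormedAddCommGroup V] [NormedSpace ℝ V] [CompleteSpace V]
    [Module ℍ[ℝ] V] [Module ℍ[ℝ]ᵐᵒᵖ V]
    [IsScalarTower ℝ ℍ[ℝ] V] [IsScalarTower ℝ ℍ[ℝ]ᵐᵒᵖ V]
    [SMulCommClass ℍ[ℝ]ᵐᵒᵖ ℍ[ℝ] V]
    [NormSMulClass ℍ[ℝ] V] [NormSMulClass ℍ[ℝ]ᵐᵒᵖ V]
    (T : V →L[ℍ[ℝ]ᵐᵒᵖ] V) (f : ℍ[ℝ] → ℍ[ℝ]) (R : ℝ) (hR : 0 < R)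
    (hσ : SCalculus.sSpectrum T ⊆ Metric.ball 0 R)
    (hf : SCalculus.IsLeftRegularOn f (Metric.ball 0 R)) :
    -- for every slice there is an admissible set with an oriented boundary
    (∀ I ∈ SCalculus.imagUnits, ∃ U : Set ℂ, SCalculus.IsAdmissible T R I U ∧
      Nonempty (SCalculus.OrientedBoundary U)) ∧
    -- the integral exists
    (∀ I ∈ SCalculus.imagUnits, ∀ U : Set ℂ, SCalculus.IsAdmissible T R I U →
      ∀ (Γ : SCalculus.OrientedBoundary U) (k : Fin Γ.n),
        IntervalIntegrable (SCalculus.cauchyIntegrand T f I (Γ.γ k)) MeasureTheory.volume 0 1) ∧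
    -- the integral depends neither on the imaginary unit nor on the open set
    (∀ I ∈ SCalculus.imagUnits, ∀ I' ∈ SCalculus.imagUnits, ∀ U U' : Set ℂ,
      SCalculus.IsAdmissible T R I U → SCalculus.IsAdmissible T R I' U' →
      ∀ (Γ : SCalculus.OrientedBoundary U) (Γ' : SCalculus.OrientedBoundary U'),
        SCalculus.cauchyIntegral T f I Γ = SCalculus.cauchyIntegral T f I' Γ') := by
  obtain ⟨a, ha⟩ := hf.exists_hasSum hR
  refine ⟨fun I hI => SCalculus.exists_isAdmissible hR hσ ⟨I, hI⟩, fun I hI U hU Γ k => ?_,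
    fun I hI I' hI' U U' hU hU' Γ Γ' => ?_⟩
  · exact SCalculus.IsAdmissible.intervalIntegrable_cauchyIntegrand (I := ⟨I, hI⟩) hU Γ k
      hf.1.continuousOn
  · exact (SCalculus.IsAdmissible.hasSum_cauchyIntegral (I := ⟨I, hI⟩) hU Γ (ha ⟨I, hI⟩)).unique
      (SCalculus.IsAdmissible.hasSum_cauchyIntegral (I := ⟨I', hI'⟩) hU' Γ' (ha ⟨I', hI'⟩))
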